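/- Let $M$ be a smooth ($C^\infty$) Hausdorff manifold of dimension $n\ge 2$ with a smooth affine connection $\nabla$, with connection coefficients $\Gamma^\mu_{\nu\sigma}$ in a chart, and let $\exp$ be its exponential map. A geodesic is a smooth curve $X\colon I\to M$ on an open interval with $\dot X\neq 0$ everywhere that satisfies $\ddot X^\mu+\Gamma^\mu_{\nu\sigma}(X)\dot X^\nu\dot X^\sigma=0$ in every chart. Fermi coordinates along a geodesic $X\colon I\to M$ with initial hyperplane $\Pi\subset T_{X(s_0)}M$, where $s_0\in I$ and $T_{X(s_0)}M=\operatorname{span}\{\dot X(s_0)\}\oplus\Pi$, are given by parallel vector fields $e_1,\dots,e_{n-1}$ along $X$ such that $e_1(s_0),\dots,e_{n-1}(s_0)$ is a basis of $\Pi$, and by an open neighbourhood $B\subset\mathbb R^{n-1}$ of $0$ such that $$f(s,z^1,\dots,z^{n-1})=\exp\Big(\sum_{i=1}^{n-1}z^ie_i(s)\Big)$$ is defined on $I\times B$ and is a diffeomorphism from $I\times B$ onto an open set $U\subset M$; the coordinates on $U$ are $x=(x^0,\dots,x^{n-1})=(s,z^1,\dots,z^{n-1})=f^{-1}$. For a geodesic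 $Y\colon K\to U$ in a chart $(U,x^\mu)$ and functions $\xi^\mu\colon K\to\mathbb R$ of class $C^2$, put $$G_U^\mu[\xi]=\ddot\xi^\mu+\Gamma^\mu_{\nu\sigma}\,(2\dot\xi^\nu\dot Y^\sigma+\dot\xi^\nu\dot\xi^\sigma)+\frac{\partial\Gamma^\mu_{\nu\sigma}}{\partial x^\alpha}\,\xi^\alpha(\dot Y^\nu+\dot\xi^\nu)(\dot Y^\sigma+\dot\xi^\sigma),$$ with $\Gamma^\mu_{\nu\sigma}$ and its derivatives evaluated at $Y$; $\xi$ is a generalized Jacobi field along $Y$ in the chart $U$ if $G_U^\mu[\xi]=0$ for all $\mu$. **Proposition.** Let $X\colon I\to M$ and $\widetilde X\colon\widetilde I\to M$ be geodesics that differ by a reparametrization, that is, $X=\widetilde X\circ\psi$ for a diffeomorphism $\psi\colon I\to\widetilde I$. Let $x=(s,z^1,\dots,z^{n-1})$ on $U$ and $\widetilde x=(\widetilde s,\widetilde z^1,\dots,\widetilde z^{n-1})$ on $\widetilde U$ be Fermi coordinates along $X$ and $\widetilde X$ with the same initial hyperplane $\Pi$ (in particular $X(s_0)=\widetilde X(\widetilde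 s_0)$). Then $X(I)\subset U\cap\widetilde U$, and $X(I)$ is contained in one connected component $W$ of $U\cap\widetilde U$. There are constants $A\neq 0$ and $B_0$ and an invertible matrix $T=(T^\mu_\nu)_{\mu,\nu=1}^{n-1}$ such that, with $L(s,z)=(As+B_0,\,Tz)$: 1. $\widetilde x=L(x)$ on $W$, that is, $\widetilde s=As+B_0$ and $\widetilde z^\mu=\sum_{\nu=1}^{n-1}T^\mu_\nu z^\nu$ for $\mu=1,\dots,n-1$. 2. More generally, the set $R$ of all $q\in U$ with $L(x(q))\in\widetilde x(\widetilde U)$ is contained in $U\cap\widetilde U$, and $\widetilde x=L(x)$ on $R$. (By 1, $W\subset R$.) 3. The generalized Jacobi equation is tensorial under this coordinate change: if $Y\colon K\to M$ is a geodesic with $Y(K)\subset R$ and $\widetilde\xi^\mu=\frac{\partial\widetilde x^\mu}{\partial x^\nu}\Big|_{Y}\xi^\nu$, then $G^\mu_{\widetilde U}[\widetilde\xi]=\frac{\partial\widetilde x^\mu}{\partial x^\nu}\Big|_{Y}\,G^\nu_U[\xi]$ for all $C^2$ functions $\xi^\mu\colon K\to\mathbb R$, and $\xi$ is a generalized Jacobi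 field along $Y$ in the chart $U$ if and only if $\widetilde\xi$ is one in the chart $\widetilde U$. -/

import Mathlib

open Set
open scoped Manifold ContDiff

noncomputable section

namespace GenJacobi

/-- The coordinate space `ℝⁿ`, `n = m + 1`, with coordinates indexed by `0, …, m`. -/
abbrev Coord (m : ℕ) : Type := EuclideanSpace ℝ (Fin (m + 1))

section Manifold

variable {m : ℕ} {M : Type*} [TopologicalSpace M] [ChartedSpace (Coord m) M]

/-- The coordinate vector field `w^σ ∂_σ` of the chart `e` with constant components `w`
(only its values on `e.source` are meaningful). -/
def coordField (e : OpenPartialHomeomorph M (Coord m)) (w : Coord m) (x : M) :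
    TangentSpace (𝓡 (m + 1)) x :=
  mfderiv (𝓡 (m + 1)) (𝓡 (m + 1)) e.symm (e x) w

/-- The components, in the chart `e`, of a tangent vector at `x`. -/
def tangentCoord (e : OpenPartialHomeomorph M (Coord m)) (x : M)
    (v : TangentSpace (𝓡 (m + 1)) x) : Coord m :=
  mfderiv (𝓡 (m + 1)) (𝓡 (m + 1)) e x v

/-- The tangent vector `Ẋ(s)` of a curve. -/
def velocity (X : ℝ → M) (s : ℝ) : TangentSpace (𝓡 (m + 1)) (X s) :=
  mfderiv 𝓘(ℝ, ℝ) (𝓡 (m + 1)) X s (1 : ℝ)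

variable [IsManifold (𝓡 (m + 1)) ∞ M]

variable (m M) in
/-- Affine connections on `M`: covariant derivatives on the tangent bundle. Smoothness is the
separate class `ContMDiffCovariantDerivative`. -/
abbrev AffineConnection :=
  CovariantDerivative (𝓡 (m + 1)) (Coord m) (TangentSpace (𝓡 (m + 1)) : M → Type _)

/-- The connection coefficients of `D` in the chart `e` at the coordinate point `y`, as the
bilinear expression `(v, w) ↦ (Γ^μ_{νσ}(y) v^ν w^σ)_μ`, i.e. the components of
`∇_{v^ν ∂_ν} (w^σ ∂_σ)` for constant `v` and `w`. -/
def christoffel (D : AffineConnection m M) (e : OpenPartialHomeomorph M (Coord m))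
    (y v w : Coord m) : Coord m :=
  tangentCoord e (e.symm y) (D (coordField e w) (e.symm y) (coordField e v (e.symm y)))

/-- Open intervals of the real line (nonempty, possibly unbounded). -/
structure IsOpenInterval (J : Set ℝ) : Prop where
  isOpen : IsOpen J
  ordConnected : J.OrdConnected
  nonempty : J.Nonempty

/-- `X` is smooth on the open set `J` and satisfies the geodesic equation
`Ẍ^μ + Γ^μ_{νσ}(X) Ẋ^ν Ẋ^σ = 0` there, in every chart of the smooth structure. Constant curves
are allowed. -/
structure SolvesGeodesicEq (D : AffineConnection m M) (J : Set ℝ) (X : ℝ → M) : Prop where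
  smooth : ContMDiffOn 𝓘(ℝ, ℝ) (𝓡 (m + 1)) ∞ X J
  eq : ∀ e ∈ IsManifold.maximalAtlas (𝓡 (m + 1)) ∞ M, ∀ s ∈ J, X s ∈ e.source →
    deriv (deriv (e ∘ X)) s
      + christoffel D e (e (X s)) (deriv (e ∘ X) s) (deriv (e ∘ X) s) = 0

/-- Affinely parametrized geodesics `X : J → M`, `J` an open interval; they are regular curves. -/
structure IsGeodesic (D : AffineConnection m M) (J : Set ℝ) (X : ℝ → M) : Prop where
  interval : IsOpenInterval J
  solves : SolvesGeodesicEq D J X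
  regular : ∀ s ∈ J, velocity (m := m) X s ≠ 0

/-- The vector field `V` along `X : J → M` is parallel:
`V̇^μ + Γ^μ_{νσ}(X) Ẋ^ν V^σ = 0` in every chart of the smooth structure. -/
def IsParallelAlong (D : AffineConnection m M) (J : Set ℝ) (X : ℝ → M)
    (V : ∀ s, TangentSpace (𝓡 (m + 1)) (X s)) : Prop :=
  ∀ e ∈ IsManifold.maximalAtlas (𝓡 (m + 1)) ∞ M, ∀ s ∈ J, X s ∈ e.source →
    HasDerivAt (fun t => tangentCoord e (X t) (V t))
      (-christoffel D e (e (X s)) (deriv (e ∘ X) s) (tangentCoord e (X s) (V s))) s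

/-- `q` is the time-one value of a solution of the geodesic equation with initial vector `u`. -/
def ExpReaches (D : AffineConnection m M) (u : TangentBundle (𝓡 (m + 1)) M) (q : M) : Prop :=
  ∃ (J : Set ℝ) (γ : ℝ → M), IsOpenInterval J ∧ (0 : ℝ) ∈ J ∧ (1 : ℝ) ∈ J ∧
    SolvesGeodesicEq D J γ ∧
    (⟨γ 0, velocity γ 0⟩ : TangentBundle (𝓡 (m + 1)) M) = u ∧ γ 1 = q

/-- The domain of the exponential map. -/
def expDomain (D : AffineConnection m M) : Set (TangentBundle (𝓡 (m + 1)) M) :=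
  {u | ∃ q, ExpReaches D u q}

open Classical in
/-- The exponential map of the connection, with an irrelevant value off `expDomain D`. (On a
Hausdorff manifold with smooth connection the point `q` with `ExpReaches D u q` is unique.) -/
def exp (D : AffineConnection m M) (u : TangentBundle (𝓡 (m + 1)) M) : M :=
  if h : ∃ q, ExpReaches D u q then h.choose else u.proj

/-- Fermi coordinates `(s, z¹, …, zᵐ)` along a curve `X : J → M` (in use, a geodesic). -/
structure FermiCoordinates (D : AffineConnection m M) (J : Set ℝ) (X : ℝ → M) where
  /-- the initial parameter value -/
  s₀ : ℝ
  s₀_mem : s₀ ∈ J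
  /-- the frame `e₁(s), …, eₘ(s)` along `X` -/
  frame : Fin m → ∀ s, TangentSpace (𝓡 (m + 1)) (X s)
  parallel : ∀ i, IsParallelAlong D J X (frame i)
  linearIndependent : LinearIndependent ℝ (fun i => frame i s₀)
  isCompl : IsCompl (Submodule.span ℝ {velocity X s₀})
    (Submodule.span ℝ (range fun i => frame i s₀))
  /-- the neighbourhood `B` of the origin over which `z = (z¹, …, zᵐ)` ranges -/
  B : Set (Fin m → ℝ)
  isOpen_B : IsOpen B
  zero_mem_B : 0 ∈ B
  /-- the coordinate chart `(s, z¹, …, zᵐ)`, the inverse of the diffeomorphism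
  `f (s, z) = exp (∑ i, zⁱ eᵢ(s))` from `J × B` onto its range -/
  chart : OpenPartialHomeomorph M (Coord m)
  chart_mem : chart ∈ IsManifold.maximalAtlas (𝓡 (m + 1)) ∞ M
  target_eq : chart.target = {x | x 0 ∈ J ∧ (fun i : Fin m => x i.succ) ∈ B}
  mem_expDomain : ∀ x ∈ chart.target,
    (⟨X (x 0), ∑ i : Fin m, x i.succ • frame i (x 0)⟩ : TangentBundle (𝓡 (m + 1)) M)
      ∈ expDomain D
  symm_eq : ∀ x ∈ chart.target,
    chart.symm x = exp D ⟨X (x 0), ∑ i : Fin m, x i.succ • frame i (x 0)⟩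

/-- The initial hyperplane `Π = span {e₁(s₀), …, eₘ(s₀)}` in `T_{X(s₀)} M`, as a subset of the
tangent bundle (so that it remembers its base point). -/
def FermiCoordinates.hyperplane {D : AffineConnection m M} {J : Set ℝ} {X : ℝ → M}
    (F : FermiCoordinates D J X) : Set (TangentBundle (𝓡 (m + 1)) M) :=
  (fun v : TangentSpace (𝓡 (m + 1)) (X F.s₀) =>
      (⟨X F.s₀, v⟩ : TangentBundle (𝓡 (m + 1)) M)) ''
    (Submodule.span ℝ (range fun i => F.frame i F.s₀) :
      Set (TangentSpace (𝓡 (m + 1)) (X F.s₀)))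

/-- The expression
`G^μ[ξ] = ξ̈^μ + Γ^μ_{νσ} (2 ξ̇^ν Ẏ^σ + ξ̇^ν ξ̇^σ) + ∂_α Γ^μ_{νσ} ξ^α (Ẏ^ν + ξ̇^ν) (Ẏ^σ + ξ̇^σ)`
in the chart `e` along the curve `Y`, with `Γ` and its derivatives evaluated at `Y(s)`. -/
def genJacobiOp (D : AffineConnection m M) (e : OpenPartialHomeomorph M (Coord m))
    (Y : ℝ → M) (ξ : ℝ → Coord m) (s : ℝ) : Coord m :=
  deriv (deriv ξ) s
    + ((2 : ℝ) • christoffel D e (e (Y s)) (deriv ξ s) (deriv (e ∘ Y) s)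
        + christoffel D e (e (Y s)) (deriv ξ s) (deriv ξ s))
    + fderiv ℝ
        (fun x => christoffel D e x (deriv (e ∘ Y) s + deriv ξ s) (deriv (e ∘ Y) s + deriv ξ s))
        (e (Y s)) (ξ s)

/-- The functions `ξ^μ` define a generalized Jacobi field along `Y : K → M` in the chart `e`. -/
structure IsGenJacobiField (D : AffineConnection m M) (e : OpenPartialHomeomorph M (Coord m))
    (K : Set ℝ) (Y : ℝ → M) (ξ : ℝ → Coord m) : Prop where
  contDiffOn : ContDiffOn ℝ 2 ξ K
  eq_zero : ∀ s ∈ K, genJacobiOp D e Y ξ s = 0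

end Manifold

/-- `X : J → M` and `X' : J' → M` differ by a reparametrization: `X = X' ∘ ψ` for a
diffeomorphism `ψ : J → J'`. -/
def IsReparametrization {M : Type*} (J : Set ℝ) (X : ℝ → M) (J' : Set ℝ) (X' : ℝ → M) : Prop :=
  ∃ ψ : ℝ → ℝ, ContDiffOn ℝ ∞ ψ J ∧ (∀ s ∈ J, deriv ψ s ≠ 0) ∧ BijOn ψ J J' ∧
    ∀ s ∈ J, X s = X' (ψ s)

/-- The affine map `(s, z) ↦ (A s + B, T z)` of coordinate space. -/
def fermiAffine {m : ℕ} (A B : ℝ) (T : Matrix (Fin m) (Fin m) ℝ) (x : Coord m) : Coord m :=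
  WithLp.toLp 2 (Fin.cons (A * x 0 + B) (fun i => ∑ j, T i j * x j.succ))

end GenJacobi

end

/-! In Fermi coordinates the axis `z = 0` is the central geodesic itself (because `exp 0 = p` at
each point `p`), so `Γ^μ_{00}` vanishes on it. Seen in the coordinates along `X'`, the curve `X` is
`s ↦ (ψ s, 0)`, and its geodesic equation collapses to `ψ'' = 0`; hence `ψ s = A s + B`
(`exists_reparametrization_eq_affine`). The two frames span the same hyperplane at the common base
point, so they differ there by an invertible matrix `T`, and uniqueness for the linear equation of
parallel transport keeps `T` constant along `X` (`frame_eq_of_affine`). Thus `∑ zⁱ eᵢ(s)` and `∑ (T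
z)ʲ e'ⱼ(A s + B)` are the same tangent vector and have the same exponential: `f x = f' (L x)`
wherever both sides are defined (`exists_symm_eq_symm_fermiAffine`). This settles `R`, and `W ⊆ R`
because `R ∩ W` is nonempty, open and closed in `W`.

Tensoriality uses only that the coordinate change is affine: its second derivatives vanish, so `Γ`
and `∂Γ` transform as tensors, and so does each term of `G` (`genJacobiOp_of_eqOn_affine`).

The only computation with `exp` is `exp_zero`, so uniqueness of geodesics is needed just for zero
initial velocity. -/

namespace GenJacobi

open Filter Topology Bundle

/-! ### Components of tangent vectors and coordinate fields in a chart -/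

section Charts

variable {m : ℕ} {M : Type*} [TopologicalSpace M] [ChartedSpace (Coord m) M]

lemma mdifferentiable_of_mem_maximalAtlas {e : OpenPartialHomeomorph M (Coord m)}
    (he : e ∈ IsManifold.maximalAtlas (𝓡 (m + 1)) ∞ M) :
    e.MDifferentiable (𝓡 (m + 1)) (𝓡 (m + 1)) :=
  ⟨(contMDiffOn_of_mem_maximalAtlas he).mdifferentiableOn (by simp),
    (contMDiffOn_symm_of_mem_maximalAtlas he).mdifferentiableOn (by simp)⟩

lemma tangentCoord_add (e : OpenPartialHomeomorph M (Coord m)) (x : M)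
    (v v' : TangentSpace (𝓡 (m + 1)) x) :
    tangentCoord e x (v + v') = tangentCoord e x v + tangentCoord e x v' :=
  map_add (mfderiv (𝓡 (m + 1)) (𝓡 (m + 1)) e x) v v'

lemma tangentCoord_smul (e : OpenPartialHomeomorph M (Coord m)) (x : M) (c : ℝ)
    (v : TangentSpace (𝓡 (m + 1)) x) :
    tangentCoord e x (c • v) = c • tangentCoord e x v :=
  map_smul (mfderiv (𝓡 (m + 1)) (𝓡 (m + 1)) e x) c v

lemma coordField_add (e : OpenPartialHomeomorph M (Coord m)) (w w' : Coord m) (x : M) :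
    coordField e (w + w') x = coordField e w x + coordField e w' x :=
  map_add (mfderiv (𝓡 (m + 1)) (𝓡 (m + 1)) e.symm (e x)) w w'

lemma coordField_smul (e : OpenPartialHomeomorph M (Coord m)) (c : ℝ) (w : Coord m) (x : M) :
    coordField e (c • w) x = c • coordField e w x :=
  map_smul (mfderiv (𝓡 (m + 1)) (𝓡 (m + 1)) e.symm (e x)) c w

lemma tangentCoord_coordField {e : OpenPartialHomeomorph M (Coord m)}
    (he : e ∈ IsManifold.maximalAtlas (𝓡 (m + 1)) ∞ M) (w : Coord m) {x : M}
    (hx : x ∈ e.source) : tangentCoord e x (coordField e w x) = w := by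
  have h := (mdifferentiable_of_mem_maximalAtlas he).comp_symm_deriv (e.map_source hx)
  rw [e.left_inv hx] at h
  exact congrArg (fun f : Coord m →L[ℝ] Coord m => f w) h

lemma tangentCoord_injective {e : OpenPartialHomeomorph M (Coord m)}
    (he : e ∈ IsManifold.maximalAtlas (𝓡 (m + 1)) ∞ M) {x : M} (hx : x ∈ e.source) :
    Function.Injective (tangentCoord e x) := by
  have h := (mdifferentiable_of_mem_maximalAtlas he).symm_comp_deriv hx
  refine Function.LeftInverse.injective
    (g := fun w => mfderiv (𝓡 (m + 1)) (𝓡 (m + 1)) e.symm (e x) w) fun v => ?_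
  exact congrArg (fun f : Coord m →L[ℝ] Coord m => f v) h

variable [IsManifold (𝓡 (m + 1)) ∞ M]

/-- The field is the constant section of coordinate space pushed forward by the tangent map of
`e.symm`. -/
lemma contMDiffOn_coordField {e : OpenPartialHomeomorph M (Coord m)}
    (he : e ∈ IsManifold.maximalAtlas (𝓡 (m + 1)) ∞ M) (w : Coord m) :
    ContMDiffOn (𝓡 (m + 1)) ((𝓡 (m + 1)).prod 𝓘(ℝ, Coord m)) ∞
      (fun x => (⟨x, coordField e w x⟩ : TangentBundle (𝓡 (m + 1)) M)) e.source := by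
  have h1 := (contMDiffOn_symm_of_mem_maximalAtlas he).contMDiffOn_tangentMapWithin
    (m := ∞) (by simp) e.open_target.uniqueMDiffOn
  have h2 : ContMDiff (𝓡 (m + 1)) (𝓡 (m + 1)).tangent ∞
      (fun y : Coord m => (⟨y, w⟩ : TangentBundle (𝓡 (m + 1)) (Coord m))) := by
    intro y
    refine (contMDiffAt_section (F := Coord m) (E := TangentSpace (𝓡 (m + 1)))
      (s := fun _ => w) y).2 ?_
    simpa using contMDiffAt_const
  have h3 := h1.comp (h2.comp_contMDiffOn (contMDiffOn_of_mem_maximalAtlas he))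
    (fun x hx => e.map_source hx)
  refine h3.congr fun x hx => ?_
  have hy := e.map_source hx
  have h4 : tangentMapWithin (𝓡 (m + 1)) (𝓡 (m + 1)) e.symm e.target
      (⟨e x, w⟩ : TangentBundle (𝓡 (m + 1)) (Coord m)) = ⟨x, coordField e w x⟩ := by
    rw [tangentMapWithin_eq_tangentMap (e.open_target.uniqueMDiffOn _ hy)
      ((mdifferentiable_of_mem_maximalAtlas he).mdifferentiableAt_symm hy)]
    simp only [tangentMap, coordField]
    exact TotalSpace.ext (e.left_inv hx) (by rfl)
  exact h4.symm

lemma mdifferentiableAt_coordField {e : OpenPartialHomeomorph M (Coord m)}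
    (he : e ∈ IsManifold.maximalAtlas (𝓡 (m + 1)) ∞ M) (w : Coord m) {x : M}
    (hx : x ∈ e.source) :
    MDifferentiableAt (𝓡 (m + 1)) ((𝓡 (m + 1)).prod 𝓘(ℝ, Coord m))
      (fun x => (⟨x, coordField e w x⟩ : TangentBundle (𝓡 (m + 1)) M)) x :=
  ((contMDiffOn_coordField he w).contMDiffAt (e.open_source.mem_nhds hx)).mdifferentiableAt
    (by simp)

lemma continuousOn_tangentCoord {e : OpenPartialHomeomorph M (Coord m)}
    (he : e ∈ IsManifold.maximalAtlas (𝓡 (m + 1)) ∞ M) :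
    ContinuousOn (fun p : TangentBundle (𝓡 (m + 1)) M => tangentCoord e p.1 p.2)
      (TotalSpace.proj ⁻¹' e.source) := by
  have h1 := (contMDiffOn_of_mem_maximalAtlas he).contMDiffOn_tangentMapWithin
    (m := ∞) (by simp) e.open_source.uniqueMDiffOn
  have h2 := (contMDiff_snd_tangentBundle_modelSpace (n := ∞) (Coord m)
    (𝓡 (m + 1))).continuous.comp_continuousOn h1.continuousOn
  refine h2.congr fun p hp => ?_
  exact congrArg (fun f : Coord m →L[ℝ] Coord m => f p.2)
    (mfderivWithin_of_isOpen e.open_source hp).symm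

end Charts

/-! ### Bilinearity, continuity and local bounds of the connection coefficients -/

section Christoffel

variable {m : ℕ} {M : Type*} [TopologicalSpace M] [ChartedSpace (Coord m) M]
  [IsManifold (𝓡 (m + 1)) ∞ M] (D : AffineConnection m M)
  {e : OpenPartialHomeomorph M (Coord m)}

lemma christoffel_add_left (y v v' w : Coord m) :
    christoffel D e y (v + v') w = christoffel D e y v w + christoffel D e y v' w := by
  simp only [christoffel, coordField_add, map_add, tangentCoord_add]

lemma christoffel_smul_left (c : ℝ) (y v w : Coord m) :
    christoffel D e y (c • v) w = c • christoffel D e y v w := by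
  simp only [christoffel, coordField_smul, map_smul, tangentCoord_smul]

lemma christoffel_add_right (he : e ∈ IsManifold.maximalAtlas (𝓡 (m + 1)) ∞ M) {y : Coord m}
    (hy : y ∈ e.target) (v w w' : Coord m) :
    christoffel D e y v (w + w') = christoffel D e y v w + christoffel D e y v w' := by
  have hx := e.map_target hy
  have h : coordField (M := M) e (w + w') = coordField e w + coordField e w' :=
    funext fun x => coordField_add e w w' x
  unfold christoffel
  rw [h, D.isCovariantDerivativeOnUniv.add (mdifferentiableAt_coordField he w hx)
    (mdifferentiableAt_coordField he w' hx), add_apply,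
    tangentCoord_add]

lemma christoffel_smul_right (he : e ∈ IsManifold.maximalAtlas (𝓡 (m + 1)) ∞ M) {y : Coord m}
    (hy : y ∈ e.target) (c : ℝ) (v w : Coord m) :
    christoffel D e y v (c • w) = c • christoffel D e y v w := by
  have hx := e.map_target hy
  have h : coordField (M := M) e (c • w) = c • coordField e w :=
    funext fun x => coordField_smul e c w x
  unfold christoffel
  rw [h, D.isCovariantDerivativeOnUniv.smul_const c (mdifferentiableAt_coordField he w hx), smul_apply,
    tangentCoord_smul]

/-- The connection coefficients at a point of the chart as a bilinear map. -/
noncomputable def christoffelBilin (he : e ∈ IsManifold.maximalAtlas (𝓡 (m + 1)) ∞ M) {y : Coord m}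
    (hy : y ∈ e.target) : Coord m →ₗ[ℝ] Coord m →ₗ[ℝ] Coord m :=
  LinearMap.mk₂ ℝ (christoffel D e y) (fun v v' w => christoffel_add_left D y v v' w)
    (fun c v w => christoffel_smul_left D c y v w)
    (fun v w w' => christoffel_add_right D he hy v w w')
    (fun c v w => christoffel_smul_right D he hy c v w)

/-- Smoothness of `D` is applied to globally smooth sections, so the coordinate field is first cut
off by a bump function supported in the chart. The cutoff equals 1 near the point, and `D` is local,
so the coefficients there do not change. -/
lemma continuousOn_christoffel [T2Space M]
    [CovariantDerivative.ContMDiffCovariantDerivative D ∞]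
    (he : e ∈ IsManifold.maximalAtlas (𝓡 (m + 1)) ∞ M) (v w : Coord m) :
    ContinuousOn (fun y => christoffel D e y v w) e.target := by
  intro y hy
  refine ContinuousAt.continuousWithinAt ?_
  set x := e.symm y with hx_def
  have hx : x ∈ e.source := e.map_target hy
  obtain ⟨f, -, hf⟩ := (SmoothBumpFunction.nhds_basis_tsupport (I := 𝓡 (m + 1)) x).mem_iff.1
    (e.open_source.mem_nhds hx)
  have hσ : ContMDiff (𝓡 (m + 1)) ((𝓡 (m + 1)).prod 𝓘(ℝ, Coord m)) ∞
      (fun z => (⟨z, ((f : M → ℝ) • coordField e w) z⟩ : TangentBundle (𝓡 (m + 1)) M)) := by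
    exact ContMDiffOn.smul_section_of_tsupport f.contMDiff.contMDiffOn e.open_source
      hf (contMDiffOn_coordField he w)
  have hD := (CovariantDerivative.ContMDiffCovariantDerivative.contMDiff
    (cov := D) (k := ∞)).contMDiff (σ := (f : M → ℝ) • coordField e w)
    (by simpa using hσ.contMDiffOn)
  have hDx := hD.contMDiffAt (x := x) univ_mem
  have happ := hDx.clm_bundle_apply
    ((contMDiffOn_coordField he v).contMDiffAt (e.open_source.mem_nhds hx))
  have hc := ((continuousOn_tangentCoord he).continuousAt
    ((e.open_source.preimage (FiberBundle.continuous_proj _ _)).mem_nhds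
      (show x ∈ e.source from hx))).comp (x := x) happ.continuousAt
  have hc' : ContinuousAt (fun z => tangentCoord e z (D (coordField e w) z (coordField e v z))) x := by
    refine hc.congr ?_
    filter_upwards [f.eventuallyEq_one.eventuallyEq_nhds, e.open_source.mem_nhds hx] with z hz hze
    have : D ((f : M → ℝ) • coordField e w) z = D (coordField e w) z := by
      refine D.isCovariantDerivativeOnUniv.congr_of_eventuallyEq
        (hσ.mdifferentiableAt (by simp)) (mdifferentiableAt_coordField he w hze) univ_mem ?_
      filter_upwards [hz] with z' hz'
      simp [hz']
    simp only [Function.comp_apply]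
    rw [this]
  exact hc'.comp (x := y) (e.symm.continuousAt hy)

/-- Expand in the standard basis: each of the finitely many coefficients is continuous, hence near
`y` at most its norm at `y` plus 1. -/
lemma exists_norm_christoffel_le [T2Space M]
    [CovariantDerivative.ContMDiffCovariantDerivative D ∞]
    (he : e ∈ IsManifold.maximalAtlas (𝓡 (m + 1)) ∞ M) {y : Coord m} (hy : y ∈ e.target) :
    ∃ C : ℝ, 0 ≤ C ∧ ∀ᶠ z in 𝓝 y, ∀ v w, ‖christoffel D e z v w‖ ≤ C * ‖v‖ * ‖w‖ := by
  let b := (EuclideanSpace.basisFun (Fin (m + 1)) ℝ)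
  let c : Fin (m + 1) → Fin (m + 1) → ℝ := fun i j => ‖christoffel D e y (b i) (b j)‖ + 1
  refine ⟨∑ i, ∑ j, c i j, by positivity, ?_⟩
  have h : ∀ i j, ∀ᶠ z in 𝓝 y, ‖christoffel D e z (b i) (b j)‖ ≤ c i j := fun i j =>
    (((continuousOn_christoffel D he (b i) (b j)).continuousAt
      (e.open_target.mem_nhds hy)).norm.eventually_lt_const
        (lt_add_one ‖christoffel D e y (b i) (b j)‖)).mono fun _ => le_of_lt
  filter_upwards [eventually_all.2 fun i => eventually_all.2 (h i), e.open_target.mem_nhds hy]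
    with z hz hze v w
  have hsum : christoffel D e z v w = ∑ i, ∑ j, (v i * w j) • christoffel D e z (b i) (b j) := by
    have hv : ∑ i, v i • b i = v := by simpa [b] using b.sum_repr v
    have hw : ∑ i, w i • b i = w := by simpa [b] using b.sum_repr w
    change christoffelBilin D he hze v w = _
    conv_lhs => rw [← hv, ← hw]
    simp only [map_sum, map_smul, LinearMap.sum_apply, LinearMap.smul_apply, Finset.smul_sum,
      smul_smul]
    rw [Finset.sum_comm]
    simp only [mul_comm (w _)]
    rfl
  rw [hsum, mul_assoc, Finset.sum_mul]
  refine (norm_sum_le _ _).trans (Finset.sum_le_sum fun i _ => ?_)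
  rw [Finset.sum_mul]
  refine (norm_sum_le _ _).trans (Finset.sum_le_sum fun j _ => ?_)
  rw [norm_smul, norm_mul, mul_comm]
  gcongr
  · exact hz i j
  · exact PiLp.norm_apply_le v i
  · exact PiLp.norm_apply_le w j

end Christoffel

/-! ### Uniqueness of the zero solution under a linear bound on the derivative -/

section Gronwall

variable {E : Type*} [NormedAddCommGroup E] [NormedSpace ℝ E]

lemma eventually_eq_zero_of_norm_deriv_le {u u' : ℝ → E} {t₀ C : ℝ}
    (h : ∀ᶠ t in 𝓝 t₀, HasDerivAt u (u' t) t ∧ ‖u' t‖ ≤ C * ‖u t‖) (h₀ : u t₀ = 0) :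
    ∀ᶠ t in 𝓝 t₀, u t = 0 := by
  obtain ⟨ε, hε, hball⟩ := Metric.eventually_nhds_iff_ball.1 h
  filter_upwards [Metric.ball_mem_nhds t₀ hε] with t ht
  rw [Real.ball_eq_Ioo] at hball ht
  rcases le_total t₀ t with hle | hle
  · have hmem : ∀ x ∈ Icc t₀ t, x ∈ Ioo (t₀ - ε) (t₀ + ε) := fun x hx =>
      ⟨by linarith [hx.1], by linarith [hx.2, ht.2]⟩
    exact eq_zero_of_abs_deriv_le_mul_abs_self_of_eq_zero_right (K := C) (f' := u')
      (fun x hx => (hball x (hmem x hx)).1.continuousAt.continuousWithinAt)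
      (fun x hx => (hball x (hmem x ⟨hx.1, hx.2.le⟩)).1.hasDerivWithinAt) h₀
      (fun x hx => (hball x (hmem x ⟨hx.1, hx.2.le⟩)).2) t ⟨hle, le_rfl⟩
  -- The Grönwall estimate runs forward in time; times before `t₀` are reached by reflecting `t ↦
  -- -t`.
  · have hmem : ∀ x ∈ Icc (-t₀) (-t), -x ∈ Ioo (t₀ - ε) (t₀ + ε) := fun x hx =>
      ⟨by linarith [hx.2, ht.1], by linarith [hx.1]⟩
    have hd : ∀ x ∈ Icc (-t₀) (-t), HasDerivAt (fun y => u (-y)) (-u' (-x)) x := fun x hx => by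
      simpa [Function.comp_def] using (hball (-x) (hmem x hx)).1.scomp x (hasDerivAt_neg x)
    have := eq_zero_of_abs_deriv_le_mul_abs_self_of_eq_zero_right (K := C)
      (f := fun y => u (-y)) (f' := fun x => -u' (-x)) (a := -t₀) (b := -t)
      (fun x hx => (hd x hx).continuousAt.continuousWithinAt)
      (fun x hx => (hd x ⟨hx.1, hx.2.le⟩).hasDerivWithinAt) (by simpa using h₀)
      (fun x hx => by simpa using (hball (-x) (hmem x ⟨hx.1, hx.2.le⟩)).2) (-t)
      ⟨by linarith, le_rfl⟩
    simpa using this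

/-- The zero set of `u` is open in `J` by the local lemma and closed by continuity. The constant may
depend on the point, so no uniform bound on `J` is required. -/
lemma eqOn_zero_of_norm_deriv_le {u u' : ℝ → E} {J : Set ℝ} (hJ : IsOpen J)
    (hJ' : IsPreconnected J) (hu : ∀ t ∈ J, HasDerivAt u (u' t) t)
    (hC : ∀ t ∈ J, ∃ C : ℝ, ∀ᶠ s in 𝓝 t, ‖u' s‖ ≤ C * ‖u s‖)
    {t₀ : ℝ} (ht₀ : t₀ ∈ J) (h₀ : u t₀ = 0) : ∀ t ∈ J, u t = 0 := by
  have hsub : J ⊆ {t | t ∈ J ∧ u t = 0} := by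
    refine hJ'.subset_of_closure_inter_subset ?_ ⟨t₀, ht₀, ht₀, h₀⟩ ?_
    · rw [isOpen_iff_mem_nhds]
      rintro t ⟨ht, hut⟩
      obtain ⟨C, hC⟩ := hC t ht
      have hev : ∀ᶠ s in 𝓝 t, HasDerivAt u (u' s) s ∧ ‖u' s‖ ≤ C * ‖u s‖ := by
        filter_upwards [hJ.mem_nhds ht, hC] with s hs hs' using ⟨hu s hs, hs'⟩
      filter_upwards [hJ.mem_nhds ht, eventually_eq_zero_of_norm_deriv_le hev hut] with s hs hs'
        using ⟨hs, hs'⟩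
    · rintro t ⟨htc, ht⟩
      refine ⟨ht, ?_⟩
      have := (hu t ht).continuousAt.continuousWithinAt.mem_closure_image htc
      refine (closure_minimal ?_ isClosed_singleton : _ ⊆ ({0} : Set E)) this
      rintro _ ⟨s, hs, rfl⟩
      exact hs.2
  exact fun t ht => (hsub ht).2

end Gronwall

/-! ### Geodesics with zero initial velocity, and `exp 0 = p` -/

section Exp

variable {m : ℕ} {M : Type*} [TopologicalSpace M] [ChartedSpace (Coord m) M]

lemma tangentCoord_zero (e : OpenPartialHomeomorph M (Coord m)) (x : M) :
    tangentCoord e x 0 = 0 :=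
  map_zero (mfderiv (𝓡 (m + 1)) (𝓡 (m + 1)) e x)

lemma deriv_comp_eq_tangentCoord {e : OpenPartialHomeomorph M (Coord m)}
    (he : e ∈ IsManifold.maximalAtlas (𝓡 (m + 1)) ∞ M) {γ : ℝ → M} {t : ℝ}
    (hγ : MDifferentiableAt 𝓘(ℝ, ℝ) (𝓡 (m + 1)) γ t) (ht : γ t ∈ e.source) :
    deriv (e ∘ γ) t = tangentCoord e (γ t) (velocity γ t) := by
  have h := mfderiv_comp t ((mdifferentiable_of_mem_maximalAtlas he).mdifferentiableAt ht) hγ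
  rw [mfderiv_eq_fderiv] at h
  rw [← fderiv_apply_one_eq_deriv]
  exact congrArg (fun f : ℝ →L[ℝ] Coord m => f 1) h

lemma contDiffAt_chart_comp {e : OpenPartialHomeomorph M (Coord m)}
    (he : e ∈ IsManifold.maximalAtlas (𝓡 (m + 1)) ∞ M) {γ : ℝ → M} {J : Set ℝ} (hJ : IsOpen J)
    (hγ : ContMDiffOn 𝓘(ℝ, ℝ) (𝓡 (m + 1)) ∞ γ J) {t : ℝ} (ht : t ∈ J) (hs : γ t ∈ e.source) :
    ContDiffAt ℝ ∞ (e ∘ γ) t := by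
  rw [← contMDiffAt_iff_contDiffAt]
  exact (contMDiffAt_of_mem_maximalAtlas he hs).comp t (hγ.contMDiffAt (hJ.mem_nhds ht))

variable [IsManifold (𝓡 (m + 1)) ∞ M] (D : AffineConnection m M)

lemma christoffel_zero_left (e : OpenPartialHomeomorph M (Coord m)) (y w : Coord m) :
    christoffel D e y 0 w = 0 := by
  simpa using christoffel_smul_left D (e := e) 0 y 0 w

variable {D}

/-- The velocity `v` satisfies `‖v'‖ ≤ C ‖v‖²`, and `‖v‖ < 1` near `t` by continuity, so the bound
becomes linear and Grönwall applies. -/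
lemma SolvesGeodesicEq.eventually_deriv_eq_zero [T2Space M]
    [CovariantDerivative.ContMDiffCovariantDerivative D ∞]
    {e : OpenPartialHomeomorph M (Coord m)}
    (he : e ∈ IsManifold.maximalAtlas (𝓡 (m + 1)) ∞ M) {γ : ℝ → M} {J : Set ℝ} (hJ : IsOpen J)
    (hγ : SolvesGeodesicEq D J γ) {t : ℝ} (ht : t ∈ J) (hs : γ t ∈ e.source)
    (h₀ : deriv (e ∘ γ) t = 0) : ∀ᶠ s in 𝓝 t, deriv (e ∘ γ) s = 0 := by
  obtain ⟨C, hC, hbound⟩ := exists_norm_christoffel_le D he (e.map_source hs)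
  have hsm := contDiffAt_chart_comp he hJ hγ.smooth ht hs
  have hcont : ContinuousAt γ t := (hγ.smooth.contMDiffAt (hJ.mem_nhds ht)).continuousAt
  have hd : ContDiffAt ℝ 1 (deriv (e ∘ γ)) t := 
    (hsm.derivWithin (m := ∞) (by simp)).of_le (by simp)
  refine eventually_eq_zero_of_norm_deriv_le (C := C)
    (u' := fun s => -christoffel D e (e (γ s)) (deriv (e ∘ γ) s) (deriv (e ∘ γ) s)) ?_ h₀
  have hsmall : ∀ᶠ s in 𝓝 t, ‖deriv (e ∘ γ) s‖ < 1 :=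
    hd.continuousAt.norm.eventually_lt_const (by simp [h₀])
  filter_upwards [hsmall, hsm.continuousAt.eventually hbound, hJ.mem_nhds ht,
    hcont.eventually_mem (e.open_source.mem_nhds hs), hd.eventually (by simp)]
    with s h1 h2 h3 h4 h5
  have h6 := hγ.eq e he s h3 h4
  constructor
  · rw [← eq_neg_of_add_eq_zero_left h6]
    exact (h5.differentiableAt (by simp)).hasDerivAt
  · rw [norm_neg]
    refine (h2 _ _).trans ?_
    gcongr
    exact mul_le_of_le_one_right hC h1.le

/-- The times at which the curve is at `p` with zero velocity form a subset open and closed in `J`.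
A single chart at `p` suffices, since the curve returns to `p` at every limit of such times. -/
lemma SolvesGeodesicEq.eq_of_velocity_eq_zero [T2Space M]
    [CovariantDerivative.ContMDiffCovariantDerivative D ∞] {γ : ℝ → M} {J : Set ℝ}
    (hJ : IsOpenInterval J) (hγ : SolvesGeodesicEq D J γ) {p : M} {t₀ : ℝ} (ht₀ : t₀ ∈ J)
    (h₀ : (⟨γ t₀, velocity γ t₀⟩ : TangentBundle (𝓡 (m + 1)) M) = ⟨p, 0⟩) :
    ∀ t ∈ J, γ t = p := by
  have he := IsManifold.chart_mem_maximalAtlas (I := 𝓡 (m + 1)) (n := ∞) p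
  set e := chartAt (Coord m) p
  have hp : p ∈ e.source := mem_chart_source _ p
  have hcont : ∀ t ∈ J, ContinuousAt γ t := fun t ht =>
    (hγ.smooth.contMDiffAt (hJ.isOpen.mem_nhds ht)).continuousAt
  have hγ₀ : γ t₀ = p := congrArg TotalSpace.proj h₀
  have hd₀ : deriv (e ∘ γ) t₀ = 0 := by
    rw [deriv_comp_eq_tangentCoord he ((hγ.smooth.contMDiffAt
      (hJ.isOpen.mem_nhds ht₀)).mdifferentiableAt (by simp)) (hγ₀ ▸ hp)]
    exact (congrArg (fun q : TangentBundle (𝓡 (m + 1)) M => tangentCoord e q.1 q.2) h₀).trans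
      (tangentCoord_zero e p)
  have hsub : J ⊆ {t | t ∈ J ∧ γ t = p ∧ deriv (e ∘ γ) t = 0} := by
    refine hJ.ordConnected.isPreconnected.subset_of_closure_inter_subset ?_
      ⟨t₀, ht₀, ht₀, hγ₀, hd₀⟩ ?_
    · rw [isOpen_iff_mem_nhds]
      rintro t ⟨ht, hγt, hdt⟩
      have hst : γ t ∈ e.source := hγt ▸ hp
      have hev := hγ.eventually_deriv_eq_zero he hJ.isOpen ht hst hdt
      have hsrc := (hcont t ht).eventually_mem (e.open_source.mem_nhds hst)
      obtain ⟨ε, hε, hball⟩ := Metric.eventually_nhds_iff_ball.1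
        (hev.and (hsrc.and (hJ.isOpen.mem_nhds ht)))
      filter_upwards [Metric.ball_mem_nhds t hε] with s hs
      refine ⟨(hball s hs).2.2, ?_, (hball s hs).1⟩
      have heq : (e ∘ γ) s = (e ∘ γ) t := by
        refine Metric.isOpen_ball.is_const_of_deriv_eq_zero
          (convex_ball t ε).isPreconnected (fun x hx => ?_) (fun x hx => (hball x hx).1) hs
          (Metric.mem_ball_self hε)
        exact ((contDiffAt_chart_comp he hJ.isOpen hγ.smooth (hball x hx).2.2
          (hball x hx).2.1).differentiableAt (by simp)).differentiableWithinAt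
      exact (e.injOn (hball s hs).2.1 hst heq).trans hγt
    · rintro t ⟨htc, ht⟩
      have hγt : γ t = p := by
        have := (hcont t ht).continuousWithinAt.mem_closure_image htc
        refine (closure_minimal ?_ isClosed_singleton : _ ⊆ ({p} : Set M)) this
        rintro _ ⟨s, hs, rfl⟩
        exact hs.2.1
      have hst : γ t ∈ e.source := hγt ▸ hp
      have hdc : ContinuousAt (deriv (e ∘ γ)) t :=
        ((contDiffAt_chart_comp he hJ.isOpen hγ.smooth ht hst).derivWithin (m := 0)
          (by norm_num)).continuousAt
      refine ⟨ht, hγt, ?_⟩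
      have := hdc.continuousWithinAt.mem_closure_image htc
      refine (closure_minimal ?_ isClosed_singleton : _ ⊆ ({0} : Set (Coord m))) this
      rintro _ ⟨s, hs, rfl⟩
      exact hs.2.2
  exact fun t ht => (hsub ht).2.1

lemma solvesGeodesicEq_const (J : Set ℝ) (p : M) : SolvesGeodesicEq D J (fun _ => p) where
  smooth := contMDiffOn_const
  eq e _ s _ _ := by
    have h : deriv (e ∘ fun _ : ℝ => p) = 0 := by
      ext1 t
      simp [Function.comp_def]
    simp [h, christoffel_zero_left]

lemma exp_zero [T2Space M] [CovariantDerivative.ContMDiffCovariantDerivative D ∞] (p : M) :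
    exp D ⟨p, 0⟩ = p := by
  have hex : ∃ q, ExpReaches D ⟨p, 0⟩ q := by
    refine ⟨p, univ, fun _ => p, ⟨isOpen_univ, ordConnected_univ, univ_nonempty⟩, mem_univ _,
      mem_univ _, solvesGeodesicEq_const _ p, ?_, rfl⟩
    have : velocity (m := m) (fun _ : ℝ => p) 0 = 0 := by
      rw [velocity, mfderiv_const]
      rfl
    rw [this]
  rw [exp, dif_pos hex]
  obtain ⟨J, γ, hJ, h0, h1, hγ, hinit, hq⟩ := hex.choose_spec
  exact hq.symm.trans (hγ.eq_of_velocity_eq_zero hJ h0 hinit 1 h1)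

end Exp

/-! ### Tensoriality of the generalized Jacobi operator under affine coordinate changes -/

section Tensoriality

variable {m : ℕ} {M : Type*} [TopologicalSpace M]
  {e e' : OpenPartialHomeomorph M (Coord m)} {R : Set M} {Λ : Coord m ≃L[ℝ] Coord m}
  {b : Coord m}

lemma fderiv_transition_of_eqOn_affine (hR : IsOpen R) (hRe : R ⊆ e.source)
    (h : ∀ q ∈ R, e' q = Λ (e q) + b) {q : M} (hq : q ∈ R) :
    fderiv ℝ (e' ∘ e.symm) (e q) = (Λ : Coord m →L[ℝ] Coord m) := by
  have hev : (e' ∘ e.symm : Coord m → Coord m) =ᶠ[𝓝 (e q)] fun y => Λ y + b := by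
    have h1 : e.symm ⁻¹' R ∈ 𝓝 (e q) := (e.symm.continuousAt (e.map_source (hRe hq)))
      (by simpa [e.left_inv (hRe hq)] using hR.mem_nhds hq)
    filter_upwards [h1, e.open_target.mem_nhds (e.map_source (hRe hq))] with y hy hyt
    simp only [Function.comp_apply]
    rw [h _ hy, e.right_inv hyt]
  rw [hev.fderiv_eq]
  exact (Λ.hasFDerivAt.add_const b).fderiv

variable [ChartedSpace (Coord m) M]

lemma tangentCoord_of_eqOn_affine (he : e ∈ IsManifold.maximalAtlas (𝓡 (m + 1)) ∞ M)
    (hR : IsOpen R) (hRe : R ⊆ e.source) (h : ∀ q ∈ R, e' q = Λ (e q) + b) {q : M} (hq : q ∈ R)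
    (v : TangentSpace (𝓡 (m + 1)) q) : tangentCoord e' q v = Λ (tangentCoord e q v) := by
  have hev : (e' : M → Coord m) =ᶠ[𝓝 q] (fun y => Λ y + b) ∘ e := by
    filter_upwards [hR.mem_nhds hq] with z hz using h z hz
  have hd : HasFDerivAt (fun y => Λ y + b) (Λ : Coord m →L[ℝ] Coord m) (e q) :=
    Λ.hasFDerivAt.add_const b
  have hcomp := (hd.hasMFDerivAt.comp q
    ((mdifferentiable_of_mem_maximalAtlas he).mdifferentiableAt (hRe hq)).hasMFDerivAt)
  exact congrArg (fun f : Coord m →L[ℝ] Coord m => f v)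
    (hcomp.congr_of_eventuallyEq hev).mfderiv

lemma coordField_of_eqOn_affine (he : e ∈ IsManifold.maximalAtlas (𝓡 (m + 1)) ∞ M)
    (he' : e' ∈ IsManifold.maximalAtlas (𝓡 (m + 1)) ∞ M)
    (hR : IsOpen R) (hRe : R ⊆ e.source) (hRe' : R ⊆ e'.source)
    (h : ∀ q ∈ R, e' q = Λ (e q) + b) {q : M} (hq : q ∈ R) (w : Coord m) :
    coordField e' (Λ w) q = coordField e w q := by
  refine tangentCoord_injective he' (hRe' hq) ?_
  rw [tangentCoord_coordField he' _ (hRe' hq), tangentCoord_of_eqOn_affine he hR hRe h hq,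
    tangentCoord_coordField he _ (hRe hq)]

variable [IsManifold (𝓡 (m + 1)) ∞ M] (D : AffineConnection m M)

/-- Under an affine change the coordinate field with constant components `w` is again one with
constant components, `Λ w`. Both sides therefore differentiate the same vector field, and the
inhomogeneous term of the usual transformation law is absent. -/
lemma christoffel_of_eqOn_affine (he : e ∈ IsManifold.maximalAtlas (𝓡 (m + 1)) ∞ M)
    (he' : e' ∈ IsManifold.maximalAtlas (𝓡 (m + 1)) ∞ M)
    (hR : IsOpen R) (hRe : R ⊆ e.source) (hRe' : R ⊆ e'.source)
    (h : ∀ q ∈ R, e' q = Λ (e q) + b) {q : M} (hq : q ∈ R) (v w : Coord m) :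
    christoffel D e' (e' q) (Λ v) (Λ w) = Λ (christoffel D e (e q) v w) := by
  have hcf := fun {z : M} (hz : z ∈ R) u => coordField_of_eqOn_affine he he' hR hRe hRe' h hz u
  unfold christoffel
  rw [e.left_inv (hRe hq), e'.left_inv (hRe' hq), hcf hq v,
    tangentCoord_of_eqOn_affine he hR hRe h hq]
  congr 3
  refine D.isCovariantDerivativeOnUniv.congr_of_eventuallyEq
    (mdifferentiableAt_coordField he' _ (hRe' hq)) (mdifferentiableAt_coordField he _ (hRe hq))
    univ_mem ?_
  filter_upwards [hR.mem_nhds hq] with z hz using hcf hz w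

lemma fderiv_christoffel_of_eqOn_affine (he : e ∈ IsManifold.maximalAtlas (𝓡 (m + 1)) ∞ M)
    (he' : e' ∈ IsManifold.maximalAtlas (𝓡 (m + 1)) ∞ M)
    (hR : IsOpen R) (hRe : R ⊆ e.source) (hRe' : R ⊆ e'.source)
    (h : ∀ q ∈ R, e' q = Λ (e q) + b) {q : M} (hq : q ∈ R) (v w u : Coord m) :
    fderiv ℝ (fun y => christoffel D e' y (Λ v) (Λ w)) (e' q) (Λ u)
      = Λ (fderiv ℝ (fun y => christoffel D e y v w) (e q) u) := by
  have hev : (fun y => Λ (christoffel D e y v w)) =ᶠ[𝓝 (e q)]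
      (fun y => christoffel D e' (y + b) (Λ v) (Λ w)) ∘ Λ := by
    have h1 : e.symm ⁻¹' R ∈ 𝓝 (e q) := (e.symm.continuousAt (e.map_source (hRe hq)))
      (by simpa [e.left_inv (hRe hq)] using hR.mem_nhds hq)
    filter_upwards [h1, e.open_target.mem_nhds (e.map_source (hRe hq))] with y hy hyt
    have h2 := christoffel_of_eqOn_affine D he he' hR hRe hRe' h hy v w
    rw [h _ hy, e.right_inv hyt] at h2
    exact h2.symm
  have h3 := hev.fderiv_eq (𝕜 := ℝ)
  have h5 : fderiv ℝ ((fun y => christoffel D e' (y + b) (Λ v) (Λ w)) ∘ Λ) (e q) =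
      (fderiv ℝ (fun y => christoffel D e' (y + b) (Λ v) (Λ w)) (Λ (e q))) ∘L
        (Λ : Coord m →L[ℝ] Coord m) := Λ.comp_right_fderiv
  have h6 : fderiv ℝ (fun y => christoffel D e' (y + b) (Λ v) (Λ w)) (Λ (e q)) =
      fderiv ℝ (fun y => christoffel D e' y (Λ v) (Λ w)) (Λ (e q) + b) :=
    fderiv_comp_add_right (𝕜 := ℝ) (f := fun y => christoffel D e' y (Λ v) (Λ w)) b
  rw [h5, h6, ← h q hq] at h3
  have h4 : fderiv ℝ (fun y => Λ (christoffel D e y v w)) (e q)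
      = (Λ : Coord m →L[ℝ] Coord m) ∘L fderiv ℝ (fun y => christoffel D e y v w) (e q) :=
    Λ.comp_fderiv
  rw [h4] at h3
  exact (congrArg (fun f : Coord m →L[ℝ] Coord m => f u) h3).symm

/-- No differentiability is needed: composing with the invertible `Λ` preserves
non-differentiability, and then both sides are the default value 0. -/
lemma deriv_continuousLinearEquiv_comp (ξ : ℝ → Coord m) (s : ℝ) :
    deriv (fun t => Λ (ξ t)) s = Λ (deriv ξ s) := by
  have h : fderiv ℝ (fun t => Λ (ξ t)) s = (Λ : Coord m →L[ℝ] Coord m) ∘L fderiv ℝ ξ s :=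
    Λ.comp_fderiv
  rw [← fderiv_apply_one_eq_deriv, h]
  simp

lemma genJacobiOp_of_eqOn_affine (he : e ∈ IsManifold.maximalAtlas (𝓡 (m + 1)) ∞ M)
    (he' : e' ∈ IsManifold.maximalAtlas (𝓡 (m + 1)) ∞ M)
    (hR : IsOpen R) (hRe : R ⊆ e.source) (hRe' : R ⊆ e'.source)
    (h : ∀ q ∈ R, e' q = Λ (e q) + b) {K : Set ℝ} (hK : IsOpen K) {Y : ℝ → M}
    (hY : ∀ s ∈ K, Y s ∈ R) {ξ ξ' : ℝ → Coord m} (hξ : ∀ s ∈ K, ξ' s = Λ (ξ s))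
    {s : ℝ} (hs : s ∈ K) : genJacobiOp D e' Y ξ' s = Λ (genJacobiOp D e Y ξ s) := by
  have hd : ∀ t ∈ K, deriv ξ' t = Λ (deriv ξ t) := fun t ht => by
    rw [← deriv_continuousLinearEquiv_comp]
    refine EventuallyEq.deriv_eq ?_
    filter_upwards [hK.mem_nhds ht] with z hz using hξ z hz
  have hdd : deriv (deriv ξ') s = Λ (deriv (deriv ξ) s) := by
    rw [← deriv_continuousLinearEquiv_comp]
    refine EventuallyEq.deriv_eq ?_
    filter_upwards [hK.mem_nhds hs] with z hz using hd z hz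
  have hdY : deriv (e' ∘ Y) s = Λ (deriv (e ∘ Y) s) := by
    have hev : (e' ∘ Y : ℝ → Coord m) =ᶠ[𝓝 s] fun t => Λ ((e ∘ Y) t) + b := by
      filter_upwards [hK.mem_nhds hs] with z hz using h _ (hY z hz)
    rw [hev.deriv_eq, deriv_add_const, deriv_continuousLinearEquiv_comp]
  unfold genJacobiOp
  rw [hdd, hd s hs, hdY, hξ s hs, ← map_add Λ (deriv (e ∘ Y) s),
    fderiv_christoffel_of_eqOn_affine D he he' hR hRe hRe' h (hY s hs),
    christoffel_of_eqOn_affine D he he' hR hRe hRe' h (hY s hs),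
    christoffel_of_eqOn_affine D he he' hR hRe hRe' h (hY s hs)]
  simp only [map_add, map_smul]

lemma isGenJacobiField_iff_of_eqOn_affine (he : e ∈ IsManifold.maximalAtlas (𝓡 (m + 1)) ∞ M)
    (he' : e' ∈ IsManifold.maximalAtlas (𝓡 (m + 1)) ∞ M)
    (hR : IsOpen R) (hRe : R ⊆ e.source) (hRe' : R ⊆ e'.source)
    (h : ∀ q ∈ R, e' q = Λ (e q) + b) {K : Set ℝ} (hK : IsOpen K) {Y : ℝ → M}
    (hY : ∀ s ∈ K, Y s ∈ R) {ξ ξ' : ℝ → Coord m} (hξ : ∀ s ∈ K, ξ' s = Λ (ξ s)) :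
    IsGenJacobiField D e K Y ξ ↔ IsGenJacobiField D e' K Y ξ' := by
  have hop := fun s (hs : s ∈ K) =>
    genJacobiOp_of_eqOn_affine D he he' hR hRe hRe' h hK hY hξ hs
  have hsm : ContDiffOn ℝ 2 ξ' K ↔ ContDiffOn ℝ 2 ξ K := by
    rw [← Λ.comp_contDiffOn_iff (f := ξ)]
    exact contDiffOn_congr hξ
  constructor
  · rintro ⟨h1, h2⟩
    exact ⟨hsm.2 h1, fun s hs => by rw [hop s hs, h2 s hs, map_zero]⟩
  · rintro ⟨h1, h2⟩
    refine ⟨hsm.1 h1, fun s hs => ?_⟩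
    have := hop s hs
    rwa [h2 s hs, eq_comm, map_eq_zero_iff Λ Λ.injective] at this

end Tensoriality

/-! ### The affine map `(s, z) ↦ (A s + B, T z)` -/

section FermiAffine

variable {m : ℕ}

/-- The unit vector along the `s`-axis of Fermi coordinate space. -/
noncomputable def axisVec (m : ℕ) : Coord m := EuclideanSpace.single 0 1

@[simp] lemma axisVec_zero : axisVec m 0 = 1 := by simp [axisVec]

@[simp] lemma axisVec_succ (i : Fin m) : axisVec m i.succ = 0 := by simp [axisVec]

@[simp] lemma fermiAffine_zero (A B : ℝ) (T : Matrix (Fin m) (Fin m) ℝ) (x : Coord m) :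
    fermiAffine A B T x 0 = A * x 0 + B := rfl

@[simp] lemma fermiAffine_succ (A B : ℝ) (T : Matrix (Fin m) (Fin m) ℝ) (x : Coord m)
    (i : Fin m) : fermiAffine A B T x i.succ = ∑ j, T i j * x j.succ := rfl

lemma fermiAffine_smul_axisVec (A B : ℝ) (T : Matrix (Fin m) (Fin m) ℝ) (s : ℝ) :
    fermiAffine A B T (s • axisVec m) = (A * s + B) • axisVec m := by
  ext i
  refine Fin.cases ?_ (fun j => ?_) i <;> simp

lemma exists_fermiAffine_eq {A : ℝ} (hA : A ≠ 0) (B : ℝ) {T : Matrix (Fin m) (Fin m) ℝ}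
    (hT : IsUnit T) : ∃ Λ : Coord m ≃L[ℝ] Coord m,
      ∀ x, fermiAffine A B T x = Λ x + B • axisVec m := by
  let f : Coord m →ₗ[ℝ] Coord m :=
    { toFun := fermiAffine A 0 T
      map_add' := fun x y => by
        ext i
        refine Fin.cases ?_ (fun j => ?_) i <;> simp [mul_add, Finset.sum_add_distrib]
      map_smul' := fun c x => by
        ext i
        refine Fin.cases ?_ (fun j => ?_) i
        · simp
          ring
        · simp [Finset.mul_sum, mul_left_comm] }
  have hf : Function.Injective f := by
    rw [← LinearMap.ker_eq_bot, LinearMap.ker_eq_bot']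
    intro x hx
    have h0 : A * x 0 + 0 = 0 := congrArg (fun y : Coord m => y 0) hx
    have h1 : T.mulVec (fun j : Fin m => x j.succ) = 0 := by
      ext i
      exact congrArg (fun y : Coord m => y i.succ) hx
    have h2 : (fun j : Fin m => x j.succ) = 0 :=
      (Matrix.mulVec_injective_iff_isUnit.2 hT) (h1.trans (Matrix.mulVec_zero T).symm)
    ext i
    refine Fin.cases ?_ (fun j => ?_) i
    · simpa [hA] using h0
    · exact congrFun h2 j
  refine ⟨(LinearEquiv.ofInjectiveEndo f hf).toContinuousLinearEquiv, fun x => ?_⟩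
  change _ = fermiAffine A 0 T x + _
  ext i
  refine Fin.cases ?_ (fun j => ?_) i <;> simp

end FermiAffine

/-! ### The axis of Fermi coordinates and affinity of the reparametrization -/

section Fermi

variable {m : ℕ} {M : Type*} [TopologicalSpace M] [ChartedSpace (Coord m) M]
  [IsManifold (𝓡 (m + 1)) ∞ M] {D : AffineConnection m M}
  {J J' : Set ℝ} {X X' : ℝ → M}

lemma FermiCoordinates.smul_axisVec_mem_target (F : FermiCoordinates D J X) {s : ℝ}
    (hs : s ∈ J) : s • axisVec m ∈ F.chart.target := by
  rw [F.target_eq]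
  refine ⟨by simpa using hs, ?_⟩
  simpa using! F.zero_mem_B

variable [T2Space M] [CovariantDerivative.ContMDiffCovariantDerivative D ∞]

lemma FermiCoordinates.symm_smul_axisVec (F : FermiCoordinates D J X) {s : ℝ} (hs : s ∈ J) :
    F.chart.symm (s • axisVec m) = X s := by
  rw [F.symm_eq _ (F.smul_axisVec_mem_target hs)]
  have h : ∑ i : Fin m, (s • axisVec m) i.succ • F.frame i ((s • axisVec m) 0) = 0 :=
    Finset.sum_eq_zero fun i _ => by
      have h0 : (s • axisVec m) i.succ = 0 := by simp
      rw [h0, zero_smul]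
  rw [h, exp_zero]
  simp

lemma FermiCoordinates.mem_source (F : FermiCoordinates D J X) {s : ℝ} (hs : s ∈ J) :
    X s ∈ F.chart.source := by
  rw [← F.symm_smul_axisVec hs]
  exact F.chart.map_target (F.smul_axisVec_mem_target hs)

lemma FermiCoordinates.chart_apply (F : FermiCoordinates D J X) {s : ℝ} (hs : s ∈ J) :
    F.chart (X s) = s • axisVec m := by
  rw [← F.symm_smul_axisVec hs, F.chart.right_inv (F.smul_axisVec_mem_target hs)]

lemma FermiCoordinates.deriv_chart_comp (F : FermiCoordinates D J X) (hJ : IsOpen J)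
    {s : ℝ} (hs : s ∈ J) : deriv (F.chart ∘ X) s = axisVec m := by
  have h : (F.chart ∘ X : ℝ → Coord m) =ᶠ[𝓝 s] fun t => t • axisVec m := by
    filter_upwards [hJ.mem_nhds hs] with t ht using F.chart_apply ht
  rw [h.deriv_eq]
  simpa using ((hasDerivAt_id s).smul_const (axisVec m)).deriv

/-- The `s`-axis of Fermi coordinates is a geodesic, so `Γ^μ_{00} = 0` on it. -/
lemma FermiCoordinates.christoffel_axisVec (F : FermiCoordinates D J X) (hX : IsGeodesic D J X)
    {s : ℝ} (hs : s ∈ J) :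
    christoffel D F.chart (s • axisVec m) (axisVec m) (axisVec m) = 0 := by
  have h := hX.solves.eq F.chart F.chart_mem s hs (F.mem_source hs)
  have hev : deriv (F.chart ∘ X) =ᶠ[𝓝 s] fun _ => axisVec m := by
    filter_upwards [hX.interval.isOpen.mem_nhds hs] with t ht
      using F.deriv_chart_comp hX.interval.isOpen ht
  rw [hev.deriv_eq, deriv_const, F.deriv_chart_comp hX.interval.isOpen hs, F.chart_apply hs,
    zero_add] at h
  exact h

/-- In the chart of `F'` the curve `X` is `ψ s • axisVec m`, so its geodesic equation reads `ψ'' +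
(ψ')² Γ_{00} = 0` with `Γ_{00} = 0` on the axis. Hence `ψ'` is constant on the interval. -/
lemma FermiCoordinates.exists_reparametrization_eq_affine (F' : FermiCoordinates D J' X')
    (hX : IsGeodesic D J X) (hX' : IsGeodesic D J' X') {ψ : ℝ → ℝ} (hψ : ContDiffOn ℝ ∞ ψ J)
    (hψ' : ∀ s ∈ J, deriv ψ s ≠ 0) (hmaps : MapsTo ψ J J') (hcomp : ∀ s ∈ J, X s = X' (ψ s)) :
    ∃ A B : ℝ, A ≠ 0 ∧ ∀ s ∈ J, ψ s = A * s + B := by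
  have hJ := hX.interval.isOpen
  have hpre := hX.interval.ordConnected.isPreconnected
  have hdiff : ∀ s ∈ J, DifferentiableAt ℝ ψ s := fun s hs =>
    (hψ.contDiffAt (hJ.mem_nhds hs)).differentiableAt (by simp)
  have hdiff2 : ∀ s ∈ J, DifferentiableAt ℝ (deriv ψ) s := fun s hs =>
    ((hψ.contDiffAt (hJ.mem_nhds hs)).derivWithin (m := ∞) (by simp)).differentiableAt (by simp)
  have h1 : ∀ s ∈ J, deriv (F'.chart ∘ X) s = deriv ψ s • axisVec m := fun s hs => by
    have hev : (F'.chart ∘ X : ℝ → Coord m) =ᶠ[𝓝 s] fun t => ψ t • axisVec m := by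
      filter_upwards [hJ.mem_nhds hs] with t ht
      rw [Function.comp_apply, hcomp t ht, F'.chart_apply (hmaps ht)]
    rw [hev.deriv_eq]
    exact ((hdiff s hs).hasDerivAt.smul_const (axisVec m)).deriv
  have h2 : ∀ s ∈ J, deriv (deriv ψ) s = 0 := fun s hs => by
    have hev : deriv (F'.chart ∘ X) =ᶠ[𝓝 s] fun t => deriv ψ t • axisVec m := by
      filter_upwards [hJ.mem_nhds hs] with t ht using h1 t ht
    have hsrc : X s ∈ F'.chart.source := by
      rw [hcomp s hs]
      exact F'.mem_source (hmaps hs)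
    have h := hX.solves.eq F'.chart F'.chart_mem s hs hsrc
    rw [hev.deriv_eq, ((hdiff2 s hs).hasDerivAt.smul_const (axisVec m)).deriv, h1 s hs,
      hcomp s hs, F'.chart_apply (hmaps hs), christoffel_smul_left,
      christoffel_smul_right D F'.chart_mem (F'.smul_axisVec_mem_target (hmaps hs)),
      F'.christoffel_axisVec hX' (hmaps hs), smul_zero, smul_zero, add_zero] at h
    simpa using congrArg (fun y : Coord m => y 0) h
  obtain ⟨s₀, hs₀⟩ := hX.interval.nonempty
  have h3 : ∀ s ∈ J, deriv ψ s = deriv ψ s₀ := fun s hs =>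
    hJ.is_const_of_deriv_eq_zero hpre (fun t ht => (hdiff2 t ht).differentiableWithinAt)
      (fun t ht => h2 t ht) hs hs₀
  refine ⟨deriv ψ s₀, ψ s₀ - deriv ψ s₀ * s₀, hψ' s₀ hs₀, fun s hs => ?_⟩
  have hd : ∀ t ∈ J, HasDerivAt (fun r => ψ r - deriv ψ s₀ * r) 0 t := fun t ht => by
    simpa [h3 t ht] using! (hdiff t ht).hasDerivAt.sub ((hasDerivAt_id t).const_mul (deriv ψ s₀))
  have := hJ.is_const_of_deriv_eq_zero hpre
    (fun t ht => (hd t ht).differentiableAt.differentiableWithinAt)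
    (fun t ht => (hd t ht).deriv) hs hs₀
  beta_reduce at this
  linarith

end Fermi

/-! ### Comparison of the parallel frames and of the two Fermi parametrizations -/

section Frames

variable {m : ℕ} {M : Type*} [TopologicalSpace M] [ChartedSpace (Coord m) M]

lemma tangentCoord_sum_smul (e : OpenPartialHomeomorph M (Coord m)) (x : M) {ι : Type*}
    (s : Finset ι) (c : ι → ℝ) (v : ι → TangentSpace (𝓡 (m + 1)) x) :
    tangentCoord e x (∑ i ∈ s, c i • v i) = ∑ i ∈ s, c i • tangentCoord e x (v i) :=
  (map_sum (mfderiv (𝓡 (m + 1)) (𝓡 (m + 1)) e x) (fun i => c i • v i) s).trans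
    (Finset.sum_congr rfl fun i _ => tangentCoord_smul e x (c i) (v i))

lemma tangentBundle_ext_of_tangentCoord {e : OpenPartialHomeomorph M (Coord m)}
    (he : e ∈ IsManifold.maximalAtlas (𝓡 (m + 1)) ∞ M) {x x' : M}
    {v : TangentSpace (𝓡 (m + 1)) x} {v' : TangentSpace (𝓡 (m + 1)) x'} (hx : x ∈ e.source)
    (h : x = x') (hv : tangentCoord e x v = tangentCoord e x' v') :
    (⟨x, v⟩ : TangentBundle (𝓡 (m + 1)) M) = ⟨x', v'⟩ := by
  subst h
  rw [tangentCoord_injective he hx hv]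

lemma linearIndependent_tangentCoord {e : OpenPartialHomeomorph M (Coord m)}
    (he : e ∈ IsManifold.maximalAtlas (𝓡 (m + 1)) ∞ M) {x : M} (hx : x ∈ e.source) {ι : Type*}
    {v : ι → TangentSpace (𝓡 (m + 1)) x} (hv : LinearIndependent ℝ v) :
    LinearIndependent ℝ fun i => tangentCoord e x (v i) :=
  hv.map' (mfderiv (𝓡 (m + 1)) (𝓡 (m + 1)) e x).toLinearMap
    (LinearMap.ker_eq_bot.2 (tangentCoord_injective he hx))

variable [IsManifold (𝓡 (m + 1)) ∞ M] {D : AffineConnection m M} {J J' : Set ℝ} {X X' : ℝ → M}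

lemma FermiCoordinates.base_eq_of_hyperplane_eq {F : FermiCoordinates D J X}
    {F' : FermiCoordinates D J' X'} (hPi : F.hyperplane = F'.hyperplane) :
    X F.s₀ = X' F'.s₀ := by
  have h : (⟨X F.s₀, 0⟩ : TangentBundle (𝓡 (m + 1)) M) ∈ F'.hyperplane := by
    rw [← hPi]
    exact ⟨0, Submodule.zero_mem _, rfl⟩
  obtain ⟨w, -, hw⟩ := h
  exact (congrArg TotalSpace.proj hw).symm

/-- The frames live in fibres over points not definitionally equal, so they are compared through
their components in one chart. The indices of `T j i` are placed so that `T` itself, not its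
transpose, acts on the coordinates `z`. -/
lemma FermiCoordinates.exists_frame_eq {F : FermiCoordinates D J X}
    {F' : FermiCoordinates D J' X'} (hPi : F.hyperplane = F'.hyperplane)
    (e : OpenPartialHomeomorph M (Coord m)) :
    ∃ T : Matrix (Fin m) (Fin m) ℝ, ∀ i, tangentCoord e (X F.s₀) (F.frame i F.s₀)
      = ∑ j, T j i • tangentCoord e (X' F'.s₀) (F'.frame j F'.s₀) := by
  have h : ∀ i, ∃ c : Fin m → ℝ, tangentCoord e (X F.s₀) (F.frame i F.s₀)
      = ∑ j, c j • tangentCoord e (X' F'.s₀) (F'.frame j F'.s₀) := fun i => by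
    have hi : (⟨X F.s₀, F.frame i F.s₀⟩ : TangentBundle (𝓡 (m + 1)) M) ∈ F'.hyperplane := by
      rw [← hPi]
      exact ⟨_, Submodule.subset_span ⟨i, rfl⟩, rfl⟩
    obtain ⟨w, hw, hw'⟩ := hi
    obtain ⟨c, rfl⟩ := (Submodule.mem_span_range_iff_exists_fun ℝ).1 hw
    refine ⟨c, ?_⟩
    rw [← tangentCoord_sum_smul]
    exact (congrArg (fun q : TangentBundle (𝓡 (m + 1)) M => tangentCoord e q.1 q.2) hw').symm
  choose c hc using h
  exact ⟨fun j i => c i j, hc⟩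

/-- Expanding each frame in the other gives matrices `T` and `S`; linear independence of the frame
of `F` forces `S * T = 1`. -/
lemma FermiCoordinates.exists_isUnit_frame_eq {F : FermiCoordinates D J X}
    {F' : FermiCoordinates D J' X'} (hPi : F.hyperplane = F'.hyperplane)
    {e : OpenPartialHomeomorph M (Coord m)}
    (he : e ∈ IsManifold.maximalAtlas (𝓡 (m + 1)) ∞ M) (hx : X F.s₀ ∈ e.source) :
    ∃ T : Matrix (Fin m) (Fin m) ℝ, IsUnit T ∧ ∀ i, tangentCoord e (X F.s₀) (F.frame i F.s₀)
      = ∑ j, T j i • tangentCoord e (X' F'.s₀) (F'.frame j F'.s₀) := by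
  obtain ⟨T, hT⟩ := exists_frame_eq hPi e
  obtain ⟨S, hS⟩ := exists_frame_eq hPi.symm e
  refine ⟨T, IsUnit.of_mul_eq_one_right S ?_, hT⟩
  have hli := linearIndependent_tangentCoord he hx F.linearIndependent
  ext k i
  have h1 : ∑ k, (S * T) k i • tangentCoord e (X F.s₀) (F.frame k F.s₀)
      = ∑ k, (1 : Matrix (Fin m) (Fin m) ℝ) k i • tangentCoord e (X F.s₀) (F.frame k F.s₀) := by
    have h2 : ∑ k, (1 : Matrix (Fin m) (Fin m) ℝ) k i • tangentCoord e (X F.s₀) (F.frame k F.s₀)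
        = tangentCoord e (X F.s₀) (F.frame i F.s₀) := by
      simp [Matrix.one_apply]
    rw [h2, hT i]
    simp only [hS, Finset.smul_sum, smul_smul, Matrix.mul_apply, Finset.sum_smul]
    rw [Finset.sum_comm]
    simp only [mul_comm]
  exact congrFun (hli.fintypeLinearCombination_injective
    (by simpa only [Fintype.linearCombination_apply] using h1)) k

/-- Parallel frames related at one point by a constant matrix are so related everywhere. -/
lemma FermiCoordinates.frame_eq_of_affine [T2Space M]
    [CovariantDerivative.ContMDiffCovariantDerivative D ∞] (F : FermiCoordinates D J X)
    (F' : FermiCoordinates D J' X') (hJ : IsOpenInterval J) (hJ' : IsOpen J') {A B : ℝ}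
    (hmaps : ∀ s ∈ J, A * s + B ∈ J') (hcomp : ∀ s ∈ J, X s = X' (A * s + B))
    {T : Matrix (Fin m) (Fin m) ℝ} {s₀ : ℝ} (hs₀ : s₀ ∈ J)
    (hT : ∀ i, tangentCoord F'.chart (X s₀) (F.frame i s₀)
      = ∑ j, T j i • tangentCoord F'.chart (X' (A * s₀ + B)) (F'.frame j (A * s₀ + B)))
    (i : Fin m) : ∀ s ∈ J, tangentCoord F'.chart (X s) (F.frame i s)
      = ∑ j, T j i • tangentCoord F'.chart (X' (A * s + B)) (F'.frame j (A * s + B)) := by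
  set e := F'.chart
  have he : e ∈ IsManifold.maximalAtlas (𝓡 (m + 1)) ∞ M := F'.chart_mem
  let y : ℝ → Coord m := fun s => (A * s + B) • axisVec m
  have hy : ∀ s ∈ J, y s ∈ e.target := fun s hs => F'.smul_axisVec_mem_target (hmaps s hs)
  have hXy : ∀ s ∈ J, e (X s) = y s := fun s hs => by
    rw [hcomp s hs, F'.chart_apply (hmaps s hs)]
  have hsrc : ∀ s ∈ J, X s ∈ e.source := fun s hs => by
    rw [hcomp s hs]
    exact F'.mem_source (hmaps s hs)
  have haff : ∀ s : ℝ, HasDerivAt (fun t => A * t + B) A s := fun s => by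
    simpa using ((hasDerivAt_id s).const_mul A).add_const B
  have hdX : ∀ s ∈ J, deriv (e ∘ X) s = A • axisVec m := fun s hs => by
    have hev : (e ∘ X : ℝ → Coord m) =ᶠ[𝓝 s] y := by
      filter_upwards [hJ.isOpen.mem_nhds hs] with t ht using hXy t ht
    rw [hev.deriv_eq]
    exact ((haff s).smul_const (axisVec m)).deriv
  -- The defect `u` solves the linear equation `u' = -Γ(Ẋ, u)`: the chain rule contributes a factor
  -- `A` to the derivative of the second frame, matching `Ẋ = A • axisVec m` in the first.
  let u : ℝ → Coord m := fun s => tangentCoord e (X s) (F.frame i s)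
    - ∑ j, T j i • tangentCoord e (X' (A * s + B)) (F'.frame j (A * s + B))
  have hu : ∀ s ∈ J, HasDerivAt u (-christoffel D e (y s) (A • axisVec m) (u s)) s := fun s hs => by
    have h1 := F.parallel i e he s hs (hsrc s hs)
    rw [hXy s hs, hdX s hs] at h1
    have h2 : ∀ j, HasDerivAt
        (fun t => tangentCoord e (X' (A * t + B)) (F'.frame j (A * t + B)))
        (-christoffel D e (y s) (A • axisVec m)
          (tangentCoord e (X' (A * s + B)) (F'.frame j (A * s + B)))) s := fun j => by
      have h3 := F'.parallel j e he _ (hmaps s hs) (F'.mem_source (hmaps s hs))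
      rw [F'.deriv_chart_comp hJ' (hmaps s hs), F'.chart_apply (hmaps s hs)] at h3
      have h4 := h3.scomp s (haff s)
      rw [christoffel_smul_left, ← smul_neg]
      exact h4
    have h5 := h1.sub (HasDerivAt.fun_sum fun j (_ : j ∈ Finset.univ) =>
      (h2 j).const_smul (T j i))
    refine h5.congr_deriv ?_
    generalize A • axisVec m = a
    change _ = -(christoffelBilin D he (hy s hs) a (u s))
    simp only [u, map_sub, map_sum, map_smul, neg_sub, smul_neg, Finset.sum_neg_distrib, sub_neg_eq_add,
      neg_add_eq_sub]
    rfl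
  have hbound : ∀ s ∈ J, ∃ C : ℝ, ∀ᶠ t in 𝓝 s,
      ‖-christoffel D e (y t) (A • axisVec m) (u t)‖ ≤ C * ‖u t‖ := fun s hs => by
    obtain ⟨C, -, hC⟩ := exists_norm_christoffel_le D he (hy s hs)
    refine ⟨C * ‖A • axisVec m‖, ?_⟩
    have hcont : ContinuousAt y s := ((haff s).smul_const (axisVec m)).continuousAt
    filter_upwards [hcont.eventually hC] with t ht
    rw [norm_neg]
    exact ht _ _
  have hzero := eqOn_zero_of_norm_deriv_le hJ.isOpen hJ.ordConnected.isPreconnected hu hbound hs₀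
    (sub_eq_zero.2 (hT i))
  exact fun s hs => sub_eq_zero.1 (hzero s hs)

lemma FermiCoordinates.exists_symm_eq_symm_fermiAffine [T2Space M]
    [CovariantDerivative.ContMDiffCovariantDerivative D ∞]
    (hX : IsGeodesic D J X) (hX' : IsGeodesic D J' X') (hrep : IsReparametrization J X J' X')
    (F : FermiCoordinates D J X) (F' : FermiCoordinates D J' X')
    (hPi : F.hyperplane = F'.hyperplane) :
    ∃ (A B : ℝ) (T : Matrix (Fin m) (Fin m) ℝ), A ≠ 0 ∧ IsUnit T ∧
      (∀ s ∈ J, A * s + B ∈ J' ∧ X s = X' (A * s + B)) ∧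
      ∀ x ∈ F.chart.target, fermiAffine A B T x ∈ F'.chart.target →
        F.chart.symm x = F'.chart.symm (fermiAffine A B T x) := by
  obtain ⟨ψ, hψ, hψ', hbij, hcomp⟩ := hrep
  obtain ⟨A, B, hA, hAB⟩ :=
    F'.exists_reparametrization_eq_affine hX hX' hψ hψ' hbij.mapsTo hcomp
  have hmaps : ∀ s ∈ J, A * s + B ∈ J' := fun s hs => hAB s hs ▸ hbij.mapsTo hs
  have hXX' : ∀ s ∈ J, X s = X' (A * s + B) := fun s hs => hAB s hs ▸ hcomp s hs
  have hsrc : ∀ s ∈ J, X s ∈ F'.chart.source := fun s hs => by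
    rw [hXX' s hs]
    exact F'.mem_source (hmaps s hs)
  obtain ⟨T, hT, hTframe⟩ := exists_isUnit_frame_eq hPi F'.chart_mem (hsrc _ F.s₀_mem)
  -- Equal base points give equal parameters, because the zeroth coordinate of `F'.chart` recovers
  -- the parameter on `X'`. The frames are thus compared at corresponding times.
  have hs₀ : F'.s₀ = A * F.s₀ + B := by
    have h := F'.chart_apply F'.s₀_mem
    rw [← base_eq_of_hyperplane_eq hPi, hXX' _ F.s₀_mem, F'.chart_apply (hmaps _ F.s₀_mem)] at h
    simpa using (congrArg (fun y : Coord m => y 0) h).symm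
  rw [hs₀] at hTframe
  have hframe := F.frame_eq_of_affine F' hX.interval hX'.interval.isOpen hmaps hXX' F.s₀_mem hTframe
  refine ⟨A, B, T, hA, hT, fun s hs => ⟨hmaps s hs, hXX' s hs⟩, fun x hx hLx => ?_⟩
  have hx0 : x 0 ∈ J := (F.target_eq ▸ hx).1
  rw [F.symm_eq x hx, F'.symm_eq _ hLx]
  -- Both sides are `exp` of the same element of the tangent bundle, so the choice made in defining
  -- `exp` is harmless.
  refine congrArg (exp D) (tangentBundle_ext_of_tangentCoord F'.chart_mem (hsrc _ hx0)
    (hXX' _ hx0) ?_)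
  rw [tangentCoord_sum_smul, tangentCoord_sum_smul]
  simp only [fermiAffine_zero, fermiAffine_succ]
  rw [Finset.sum_congr rfl fun i _ => by rw [hframe i _ hx0]]
  simp only [Finset.smul_sum, smul_smul, Finset.sum_smul]
  rw [Finset.sum_comm]
  simp only [mul_comm]

end Frames

end GenJacobi

/-! ### The proposition -/

open GenJacobi Topology

theorem mainTheorem3 {m : ℕ} {M : Type*} [TopologicalSpace M] [T2Space M]
    [ChartedSpace (GenJacobi.Coord m) M] [IsManifold (𝓡 (m + 1)) ∞ M]
    (D : GenJacobi.AffineConnection m M)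
    [CovariantDerivative.ContMDiffCovariantDerivative D ∞]
    (J J' : Set ℝ) (X X' : ℝ → M)
    (hX : GenJacobi.IsGeodesic D J X) (hX' : GenJacobi.IsGeodesic D J' X')
    (hrep : GenJacobi.IsReparametrization J X J' X')
    (F : GenJacobi.FermiCoordinates D J X) (F' : GenJacobi.FermiCoordinates D J' X')
    (hPi : F.hyperplane = F'.hyperplane) :
    -- the connected component of the common domain that contains the central geodesic
    let W : Set M := connectedComponentIn (F.chart.source ∩ F'.chart.source) (X F.s₀)
    (∀ s ∈ J, X s ∈ W) ∧
    ∃ (A B : ℝ) (T : Matrix (Fin m) (Fin m) ℝ), A ≠ 0 ∧ IsUnit T ∧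
      (∀ q ∈ W, F'.chart q = GenJacobi.fermiAffine A B T (F.chart q)) ∧
      (∀ q ∈ F.chart.source, GenJacobi.fermiAffine A B T (F.chart q) ∈ F'.chart.target →
        q ∈ F'.chart.source ∧ F'.chart q = GenJacobi.fermiAffine A B T (F.chart q)) ∧
      -- along geodesics in the region where the coordinates are so related, the components
      -- `ξ^μ ↦ (∂x'^μ/∂x^ν) ξ^ν` of the generalized Jacobi equation transform as a vector
      (∀ (K : Set ℝ) (Y : ℝ → M), GenJacobi.IsGeodesic D K Y →
        (∀ s ∈ K, Y s ∈ F.chart.source ∧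
          GenJacobi.fermiAffine A B T (F.chart (Y s)) ∈ F'.chart.target) →
        ∀ ξ ξ' : ℝ → GenJacobi.Coord m,
          (∀ s ∈ K, ξ' s = fderiv ℝ (F'.chart ∘ F.chart.symm) (F.chart (Y s)) (ξ s)) →
          (ContDiffOn ℝ 2 ξ K → ∀ s ∈ K,
            GenJacobi.genJacobiOp D F'.chart Y ξ' s =
              fderiv ℝ (F'.chart ∘ F.chart.symm) (F.chart (Y s))
                (GenJacobi.genJacobiOp D F.chart Y ξ s)) ∧
          (GenJacobi.IsGenJacobiField D F.chart K Y ξ ↔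
            GenJacobi.IsGenJacobiField D F'.chart K Y ξ')) := by
  intro W
  obtain ⟨A, B, T, hA, hT, hXX', hsymm⟩ :=
    FermiCoordinates.exists_symm_eq_symm_fermiAffine hX hX' hrep F F' hPi
  obtain ⟨Λ, hΛ⟩ := exists_fermiAffine_eq hA B hT
  have hXmem : ∀ s ∈ J, X s ∈ F.chart.source ∩ F'.chart.source := fun s hs =>
    ⟨F.mem_source hs, (hXX' s hs).2 ▸ F'.mem_source (hXX' s hs).1⟩
  have hXW : ∀ s ∈ J, X s ∈ W := fun s hs => by
    refine (hX.interval.ordConnected.isPreconnected.image X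
      hX.solves.smooth.continuousOn).subset_connectedComponentIn ⟨_, F.s₀_mem, rfl⟩ ?_ ⟨s, hs, rfl⟩
    rintro _ ⟨t, ht, rfl⟩
    exact hXmem t ht
  -- Here `q = f (x q) = f' (L (x q))`, which exhibits `q` as a point of the second chart with
  -- coordinates `L (x q)`.
  have hregion : ∀ q ∈ F.chart.source, fermiAffine A B T (F.chart q) ∈ F'.chart.target →
      q ∈ F'.chart.source ∧ F'.chart q = fermiAffine A B T (F.chart q) := fun q hq hLq => by
    have h := hsymm _ (F.chart.map_source hq) hLq
    rw [F.chart.left_inv hq] at h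
    constructor
    · rw [h]
      exact F'.chart.map_target hLq
    · conv_lhs => rw [h]
      exact F'.chart.right_inv hLq
  have hLcont : Continuous (fermiAffine A B T) := by
    rw [funext hΛ]
    exact Λ.continuous.add continuous_const
  let R : Set M := F.chart.source ∩ F.chart ⁻¹' (fermiAffine A B T ⁻¹' F'.chart.target)
  have hRopen : IsOpen R :=
    F.chart.isOpen_inter_preimage (F'.chart.open_target.preimage hLcont)
  have hWsub : W ⊆ F.chart.source ∩ F'.chart.source := connectedComponentIn_subset _ _
  have hWR : W ⊆ R := by
    refine isPreconnected_connectedComponentIn.subset_of_closure_inter_subset hRopen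
      ⟨X F.s₀, hXW _ F.s₀_mem, F.mem_source F.s₀_mem, ?_⟩ ?_
    · rw [mem_preimage, mem_preimage, F.chart_apply F.s₀_mem, fermiAffine_smul_axisVec]
      exact F'.smul_axisVec_mem_target (hXX' _ F.s₀_mem).1
    · rintro q ⟨hqR, hqW⟩
      have hq := hWsub hqW
      -- Relative closedness: both sides are continuous at `q` and agree on `R`, which accumulates
      -- at `q`. Their equality at `q` then puts `L (x q)` in the target of the second chart.
      have heq : F'.chart q = fermiAffine A B T (F.chart q) := by
        have : (𝓝[R] q).NeBot := mem_closure_iff_nhdsWithin_neBot.1 hqR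
        refine tendsto_nhds_unique_of_eventuallyEq (l := 𝓝[R] q)
          (F'.chart.continuousAt hq.2).continuousWithinAt
          ((hLcont.continuousAt.comp (F.chart.continuousAt hq.1)).continuousWithinAt) ?_
        filter_upwards [self_mem_nhdsWithin] with z hz using (hregion z hz.1 hz.2).2
      refine ⟨hq.1, ?_⟩
      rw [mem_preimage, mem_preimage, ← heq]
      exact F'.chart.map_source hq.2
  refine ⟨hXW, A, B, T, hA, hT, fun q hq => (hregion q (hWR hq).1 (hWR hq).2).2, hregion, ?_⟩
  intro K Y hY hYR ξ ξ' hξ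
  have hRaff : ∀ q ∈ R, F'.chart q = Λ (F.chart q) + B • axisVec m := fun q hq =>
    (hregion q hq.1 hq.2).2.trans (hΛ _)
  have hRe : R ⊆ F.chart.source := fun q hq => hq.1
  have hRe' : R ⊆ F'.chart.source := fun q hq => (hregion q hq.1 hq.2).1
  have hfd : ∀ s ∈ K, fderiv ℝ (F'.chart ∘ F.chart.symm) (F.chart (Y s))
      = (Λ : Coord m →L[ℝ] Coord m) := fun s hs =>
    fderiv_transition_of_eqOn_affine hRopen hRe hRaff (hYR s hs)
  have hξΛ : ∀ s ∈ K, ξ' s = Λ (ξ s) := fun s hs => by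
    rw [hξ s hs, hfd s hs]
    rfl
  refine ⟨fun _ s hs => ?_, isGenJacobiField_iff_of_eqOn_affine D F.chart_mem F'.chart_mem hRopen
    hRe hRe' hRaff hY.interval.isOpen hYR hξΛ⟩
  rw [hfd s hs]
  exact genJacobiOp_of_eqOn_affine D F.chart_mem F'.chart_mem hRopen hRe hRe' hRaff
    hY.interval.isOpen hYR hξΛ hs
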